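/- There is a universal constant $c>0$ such that the following holds for every integer $n\ge 2$ and all laws $\mu_\xi,\mu_\zeta$ on $\mathbb{R}$ with finite fourth moment, $\int x^4\,\mu_\xi(dx)<\infty$ and $\int x^4\,\mu_\zeta(dx)<\infty$. Let $\xi_1,\ldots,\xi_n$ be i.i.d. with law $\mu_\xi$, let $\zeta_1,\ldots,\zeta_n$ be i.i.d. with law $\mu_\zeta$, and let $U$ be uniformly distributed on $\{1,\ldots,n\}$, where $(\xi_i)_{i\le n}$, $(\zeta_i)_{i\le n}$ and $U$ are independent. Let $\xi_{(1)}\le\ldots\le\xi_{(n)}$ and $\zeta_{(1)}\le\ldots\le\zeta_{(n)}$ be the ranked values of $\xi_1,\ldots,\xi_n$ and of $\zeta_1,\ldots,\zeta_n$, respectively. Then $\xi_{(U)}$ has law $\mu_\xi$, $\zeta_{(U)}$ has law $\mu_\zeta$, $\mathcal{W}_2(\mu_\xi,\mu_\zeta)$ is finite, $(\xi_{(U)}-\zeta_{(U)})^2$ is integrable, and $$\mathbb{E}\big(\xi_{(U)}-\zeta_{(U)}\big)^2\le 3\,\mathcal{W}_2^2(\mu_\xi,\mu_\zeta)+\frac{c\log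 n}{\sqrt n}\Big(\sqrt{\int x^4\,\mu_\xi(dx)}+\sqrt{\int x^4\,\mu_\zeta(dx)}\Big),$$ where $\mathcal{W}_2(\mu,\nu)=\inf\big(\mathbb{E}|X-Y|^2\big)^{1/2}$, the infimum being over all couplings $(X,Y)$ of $\mu$ and $\nu$. The constant $c$ does not depend on $\mu_\xi$, $\mu_\zeta$ or $n$. -/

import Mathlib

open MeasureTheory ProbabilityTheory
open scoped ENNReal

noncomputable section

/-- The ranked values `x_(1) ≤ … ≤ x_(n)` of `x_1, …, x_n`, listed with multiplicity. Indices are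
zero-based: `orderStat x i` is the value of rank `i + 1`. -/
def orderStat {n : ℕ} (x : Fin n → ℝ) (i : Fin n) : ℝ :=
  x (Tuple.sort x i)

/-- The couplings of `μ` and `ν`: the joint laws on `ℝ × ℝ` with marginals `μ` and `ν`. -/
def couplings (μ ν : Measure ℝ) : Set (Measure (ℝ × ℝ)) :=
  {γ | γ.map Prod.fst = μ ∧ γ.map Prod.snd = ν}

/-- The Wasserstein distance `W₂(μ, ν) = inf (E |X - Y|²)^(1/2)`, the infimum being over all
couplings `(X, Y)` of `μ` and `ν`. It takes values in `[0, ∞]`. -/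
def wasserstein2 (μ ν : Measure ℝ) : ℝ≥0∞ :=
  ⨅ γ ∈ couplings μ ν, (∫⁻ p, ENNReal.ofReal (|p.1 - p.2| ^ 2) ∂γ) ^ (1 / 2 : ℝ)

end

/-! Averaging over `U` turns the left side into `1/n` times the expected `rankedSqDist` of the two
samples. Fix a coupling of `μξ` and `μζ`, draw `n` independent pairs `(x i, y i)` from it, and let
`z` be a further independent sample of `μζ`. Then `(x, z)` has the law of the two given samples, and
`rankedSqDist x z ≤ 2 * rankedSqDist x y + 2 * rankedSqDist y z`.

By rearrangement, sorting costs no more than the pairing `x i ↔ y i`, so the first term contributes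
twice the coupling cost; taking the infimum gives `2 W₂²`.

The second term compares two independent samples of one law (`lintegral_rankedSqDist_prod_self_le`).
The signed square `t * |t|` reduces squared distance to an L¹ distance, which is the integral over
levels `u` of the difference of two binomial counts. With `p` the probability that `t * |t| ≤ u`,
its mean is at most `2 min(√(n p(1-p)), 2 n p(1-p))`, where `p(1-p) ≤ min(1/4, s²/u²)` and `s²`
bounds the fourth moment. Integrating over `u` gives order `s √n (1 + log n)`, the logarithm coming
from the `1/u` range. -/

/-! ### Ranked values and the squared distance between ranked tuples. -/

theorem monotone_orderStat {n : ℕ} (x : Fin n → ℝ) : Monotone (orderStat x) :=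
  Tuple.monotone_sort x

theorem sum_orderStat {n : ℕ} {M : Type*} [AddCommMonoid M] (x : Fin n → ℝ) (g : ℝ → M) :
    ∑ i, g (orderStat x i) = ∑ i, g (x i) :=
  Equiv.sum_comp (Tuple.sort x) fun i => g (x i)

theorem measurable_orderStat {n : ℕ} (i : Fin n) :
    Measurable fun x : Fin n → ℝ => orderStat x i := by
  refine measurable_of_Iic fun t => ?_
  -- Ranks are zero-based, so the count of entries below `t` must strictly exceed `i`.
  have key : (fun x : Fin n → ℝ => orderStat x i) ⁻¹' Set.Iic t =
      {x | ((i : ℕ) : ℝ) < ∑ j, if x j ≤ t then (1 : ℝ) else 0} := by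
    ext x
    have h1 := Tuple.lt_card_le_iff_apply_le_of_monotone (f := orderStat x) (a := t) (j := i)
      (monotone_orderStat x)
    have h2 := sum_orderStat x fun y => if y ≤ t then (1 : ℝ) else 0
    rw [Finset.sum_boole] at h2
    simp only [Set.mem_preimage, Set.mem_Iic, Set.mem_ofPred_eq, ← h2, Nat.cast_lt, h1]
  rw [key]
  refine measurableSet_lt measurable_const (Finset.measurable_sum _ fun j _ => ?_)
  exact Measurable.ite (measurableSet_le (measurable_pi_apply j) measurable_const)
    measurable_const measurable_const

/-- The squared Euclidean distance between the ranked values of two tuples. -/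
noncomputable def rankedSqDist {n : ℕ} (x y : Fin n → ℝ) : ℝ≥0∞ :=
  ∑ i, ENNReal.ofReal ((orderStat x i - orderStat y i) ^ 2)

theorem Measurable.rankedSqDist {α : Type*} [MeasurableSpace α] {n : ℕ}
    {f g : α → Fin n → ℝ} (hf : Measurable f) (hg : Measurable g) :
    Measurable fun a => rankedSqDist (f a) (g a) :=
  Finset.measurable_sum _ fun i _ => (((measurable_orderStat i).comp hf).sub
    ((measurable_orderStat i).comp hg)).pow_const 2 |>.ennreal_ofReal

theorem rankedSqDist_le_two_mul_add {n : ℕ} (x y z : Fin n → ℝ) :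
    rankedSqDist x z ≤ 2 * rankedSqDist x y + 2 * rankedSqDist y z := by
  unfold rankedSqDist
  rw [Finset.mul_sum, Finset.mul_sum, ← Finset.sum_add_distrib]
  refine Finset.sum_le_sum fun i _ => ?_
  rw [← ENNReal.ofReal_ofNat 2, ← ENNReal.ofReal_mul (by norm_num),
    ← ENNReal.ofReal_mul (by norm_num), ← ENNReal.ofReal_add (by positivity) (by positivity)]
  refine ENNReal.ofReal_le_ofReal ?_
  nlinarith [sq_nonneg (orderStat x i - orderStat y i - (orderStat y i - orderStat z i))]

theorem rankedSqDist_le_sum {n : ℕ} (x y : Fin n → ℝ) :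
    rankedSqDist x y ≤ ∑ i, ENNReal.ofReal ((x i - y i) ^ 2) := by
  unfold rankedSqDist
  rw [← ENNReal.ofReal_sum_of_nonneg fun i _ => by positivity,
    ← ENNReal.ofReal_sum_of_nonneg fun i _ => by positivity]
  refine ENNReal.ofReal_le_ofReal ?_
  have hmono : Monovary (orderStat x) (orderStat y) :=
    (monotone_orderStat x).monovary (monotone_orderStat y)
  -- Rearrangement inequality, for the permutation that restores the original pairing of `x i` with
  -- `y i`.
  have h := hmono.sum_mul_comp_perm_le_sum_mul
    (σ := (Tuple.sort x).trans (Tuple.sort y).symm)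
  have h3 : ∑ i, orderStat x i * orderStat y (((Tuple.sort x).trans (Tuple.sort y).symm) i)
      = ∑ i, x i * y i := by
    rw [← Equiv.sum_comp (Tuple.sort x) fun i => x i * y i]
    simp [orderStat]
  have hx := sum_orderStat x fun t => t ^ 2
  have hy := sum_orderStat y fun t => t ^ 2
  simp only [sub_sq, Finset.sum_add_distrib, Finset.sum_sub_distrib, mul_assoc,
    ← Finset.mul_sum]
  rw [h3] at h
  linarith

/-! ### Reduction of the ranked distance to differences of counting functions. -/

theorem ofReal_abs_sub_eq_lintegral (a b : ℝ) :
    ENNReal.ofReal |a - b| =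
      ∫⁻ u, ENNReal.ofReal |(if a ≤ u then (1 : ℝ) else 0) - if b ≤ u then 1 else 0| := by
  have h : (fun u => ENNReal.ofReal |(if a ≤ u then (1 : ℝ) else 0) - if b ≤ u then 1 else 0|)
      = (Set.Ico (min a b) (max a b)).indicator 1 := by
    funext u
    by_cases ha : a ≤ u <;> by_cases hb : b ≤ u <;>
      simp [Set.indicator, ha, hb, lt_of_not_ge, not_lt_of_ge]
  rw [h, lintegral_indicator_one measurableSet_Ico, Real.volume_Ico, max_sub_min_eq_abs']

/-- Sublevel sets of monotone tuples are initial segments, hence nested, so all the differences have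
the same sign. -/
theorem sum_abs_sub_ite_eq {n : ℕ} {f g : Fin n → ℝ} (hf : Monotone f) (hg : Monotone g) (u : ℝ) :
    ∑ i, |(if f i ≤ u then (1 : ℝ) else 0) - if g i ≤ u then 1 else 0| =
      |∑ i, ((if f i ≤ u then (1 : ℝ) else 0) - if g i ≤ u then 1 else 0)| := by
  by_cases h : ∃ i, f i ≤ u ∧ u < g i
  · obtain ⟨i, hi, hi'⟩ := h
    have key : ∀ j, 0 ≤ (if f j ≤ u then (1 : ℝ) else 0) - if g j ≤ u then 1 else 0 := by
      intro j
      by_cases hj : f j ≤ u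
      · simp only [hj, if_true]; split_ifs <;> norm_num
      · have hij : i ≤ j := by
          by_contra hc
          exact hj ((hf (le_of_not_ge hc)).trans hi)
        simp [hj, not_le_of_gt (hi'.trans_le (hg hij))]
    rw [abs_of_nonneg (Finset.sum_nonneg fun j _ => key j)]
    exact Finset.sum_congr rfl fun j _ => abs_of_nonneg (key j)
  · push Not at h
    have key : ∀ j, (if f j ≤ u then (1 : ℝ) else 0) - (if g j ≤ u then 1 else 0) ≤ 0 := by
      intro j
      by_cases hj : f j ≤ u
      · simp [hj, h j hj]
      · simp only [hj, if_false]; split_ifs <;> norm_num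
    rw [abs_of_nonpos (Finset.sum_nonpos fun j _ => key j), ← Finset.sum_neg_distrib]
    exact Finset.sum_congr rfl fun j _ => abs_of_nonpos (key j)

theorem sum_ofReal_abs_sub_eq_lintegral {n : ℕ} {f g : Fin n → ℝ}
    (hf : Monotone f) (hg : Monotone g) :
    ∑ i, ENNReal.ofReal |f i - g i| = ∫⁻ u, ENNReal.ofReal
      |∑ i, ((if f i ≤ u then (1 : ℝ) else 0) - if g i ≤ u then 1 else 0)| := by
  rw [Finset.sum_congr rfl fun i _ => ofReal_abs_sub_eq_lintegral (f i) (g i),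
    ← lintegral_finsetSum]
  · refine lintegral_congr fun u => ?_
    rw [← ENNReal.ofReal_sum_of_nonneg fun i _ => abs_nonneg _, sum_abs_sub_ite_eq hf hg]
  · intro i _
    have h (a : ℝ) : Measurable fun u : ℝ => if a ≤ u then (1 : ℝ) else 0 :=
      Measurable.ite measurableSet_Ici measurable_const measurable_const
    exact ((h _).sub (h _)).abs.ennreal_ofReal

theorem monotone_mul_abs : Monotone fun x : ℝ => x * |x| := by
  intro a b hab
  rcases abs_cases a with ⟨h, h'⟩ | ⟨h, h'⟩ <;> rcases abs_cases b with ⟨k, k'⟩ | ⟨k, k'⟩ <;>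
    simp only [h, k] <;> nlinarith

/-- For equal signs, `|a - b| ≤ |a + b|`; for opposite signs the right side is `2 (a² + b²)`, which
is where the factor 2 is needed. -/
theorem sq_sub_le_two_mul_abs (a b : ℝ) : (a - b) ^ 2 ≤ 2 * |(a * |a|) - (b * |b|)| := by
  wlog hab : b ≤ a generalizing a b
  · rw [abs_sub_comm, ← neg_sub, neg_sq]
    exact this b a (le_of_not_ge hab)
  rw [abs_of_nonneg (sub_nonneg.2 (monotone_mul_abs hab))]
  have hd := sub_nonneg.2 hab
  rcases abs_cases a with ⟨h, h'⟩ | ⟨h, h'⟩ <;> rcases abs_cases b with ⟨k, k'⟩ | ⟨k, k'⟩ <;>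
    simp only [h, k]
  · nlinarith [mul_nonneg hd h', mul_nonneg hd k']
  · nlinarith [sq_nonneg (a + b)]
  · nlinarith
  · nlinarith [mul_nonneg hd (neg_nonneg.2 h'.le), mul_nonneg hd (neg_nonneg.2 k'.le)]

theorem rankedSqDist_le_lintegral {n : ℕ} (x y : Fin n → ℝ) :
    rankedSqDist x y ≤ 2 * ∫⁻ u, ENNReal.ofReal
      |∑ i, (if x i * |x i| ≤ u then (1 : ℝ) else 0) -
        ∑ i, if y i * |y i| ≤ u then (1 : ℝ) else 0| := by
  have h := sum_ofReal_abs_sub_eq_lintegral (monotone_mul_abs.comp (monotone_orderStat x))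
    (monotone_mul_abs.comp (monotone_orderStat y))
  simp only [Function.comp_apply, Finset.sum_sub_distrib] at h
  simp_rw [fun u : ℝ => sum_orderStat x fun t => if t * |t| ≤ u then (1 : ℝ) else 0,
    fun u : ℝ => sum_orderStat y fun t => if t * |t| ≤ u then (1 : ℝ) else 0] at h
  rw [← h, Finset.mul_sum]
  refine Finset.sum_le_sum fun i _ => ?_
  rw [← ENNReal.ofReal_ofNat 2, ← ENNReal.ofReal_mul (by norm_num)]
  exact ENNReal.ofReal_le_ofReal (sq_sub_le_two_mul_abs _ _)

/-! ### Mean deviation of binomial counts. -/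

section Deviation

variable {α : Type*} [MeasurableSpace α] (ν : Measure α) [IsProbabilityMeasure ν]

theorem measurable_ite_mem {s : Set α} (hs : MeasurableSet s) [DecidablePred (· ∈ s)] :
    Measurable fun a => if a ∈ s then (1 : ℝ) else 0 :=
  Measurable.ite hs measurable_const measurable_const

/-- Any function of an indicator is affine in it, so this one formula yields its mean, mean absolute
deviation and variance. -/
theorem integral_affine_ite {s : Set α} (hs : MeasurableSet s) [DecidablePred (· ∈ s)] (b c : ℝ) :
    ∫ a, ((if a ∈ s then (1 : ℝ) else 0) * b + c) ∂ν = ν.real s * b + c := by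
  have h : (fun a => if a ∈ s then (1 : ℝ) else 0) = s.indicator 1 := by
    funext a; simp [Set.indicator]
  have hi : Integrable (fun a => if a ∈ s then (1 : ℝ) else 0) ν := by
    rw [h]; exact (integrable_const 1).indicator hs
  rw [integral_add (hi.mul_const b) (integrable_const c), integral_mul_const, h,
    integral_indicator_one hs]
  simp

theorem integral_abs_ite_sub_measureReal {s : Set α} (hs : MeasurableSet s)
    [DecidablePred (· ∈ s)] :
    ∫ a, |(if a ∈ s then (1 : ℝ) else 0) - ν.real s| ∂ν
      = 2 * (ν.real s * (1 - ν.real s)) := by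
  have h0 : 0 ≤ ν.real s := measureReal_nonneg
  have h1 : ν.real s ≤ 1 := measureReal_le_one
  rw [show 2 * (ν.real s * (1 - ν.real s)) = ν.real s * (1 - 2 * ν.real s) + ν.real s by ring,
    ← integral_affine_ite ν hs]
  refine integral_congr_ae (.of_forall fun a => ?_)
  by_cases ha : a ∈ s
  · simp only [ha, if_true, abs_of_nonneg (sub_nonneg.2 h1)]; ring
  · simp [ha, abs_of_nonneg h0]

theorem variance_ite_mem {s : Set α} (hs : MeasurableSet s) [DecidablePred (· ∈ s)] :
    Var[fun a => if a ∈ s then (1 : ℝ) else 0; ν] = ν.real s * (1 - ν.real s) := by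
  rw [variance_eq_integral (measurable_ite_mem hs).aemeasurable]
  have hm : ∫ a, (if a ∈ s then (1 : ℝ) else 0) ∂ν = ν.real s := by
    simpa using integral_affine_ite ν hs 1 0
  rw [hm, show ν.real s * (1 - ν.real s) = ν.real s * (1 - 2 * ν.real s) + ν.real s ^ 2 by ring,
    ← integral_affine_ite ν hs]
  refine integral_congr_ae (.of_forall fun a => ?_)
  by_cases ha : a ∈ s
  · simp only [ha, if_true]; ring
  · simp [ha]

theorem memLp_ite_mem {s : Set α} (hs : MeasurableSet s) [DecidablePred (· ∈ s)] (p : ℝ≥0∞) :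
    MemLp (fun a => if a ∈ s then (1 : ℝ) else 0) p ν :=
  MemLp.of_bound (measurable_ite_mem hs).aestronglyMeasurable 1 <| .of_forall fun a => by
    split_ifs <;> simp

/-- The mean absolute deviation of a binomial count is at most both its standard deviation and
the sum of the mean absolute deviations of the individual indicators. -/
theorem integral_abs_count_sub_le (n : ℕ) {s : Set α} (hs : MeasurableSet s)
    [DecidablePred (· ∈ s)] :
    ∫ x : Fin n → α, |(∑ i, if x i ∈ s then (1 : ℝ) else 0) - n * ν.real s|
        ∂(Measure.pi fun _ => ν)
      ≤ min (√(n * (ν.real s * (1 - ν.real s)))) (2 * (n * (ν.real s * (1 - ν.real s)))) := by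
  set P : Measure (Fin n → α) := Measure.pi fun _ => ν
  set X : Fin n → (Fin n → α) → ℝ := fun i x => if x i ∈ s then (1 : ℝ) else 0
  have hmp (i : Fin n) : MeasurePreserving (Function.eval i) P ν := measurePreserving_eval _ i
  have hX (i : Fin n) : MemLp (X i) 2 P := (memLp_ite_mem ν hs 2).comp_measurePreserving (hmp i)
  have hXm (i : Fin n) : Measurable (X i) := (measurable_ite_mem hs).comp (measurable_pi_apply i)
  have hXi (i : Fin n) : Integrable (X i) P := (hX i).integrable (by norm_num)
  have hmean (i : Fin n) : ∫ x, X i x ∂P = ν.real s := by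
    have h := integral_affine_ite ν hs 1 0
    rw [← (hmp i).map_eq, integral_map (hmp i).measurable.aemeasurable
      (by simpa using (measurable_ite_mem hs).aestronglyMeasurable)] at h
    simpa [(hmp i).map_eq] using h
  have hS : MemLp (fun x => ∑ i, X i x) 2 P := memLp_finsetSum _ fun i _ => hX i
  have hSmean : ∫ x, ∑ i, X i x ∂P = n * ν.real s := by
    rw [integral_finsetSum _ fun i _ => hXi i]
    simp [hmean]
  have hD : MemLp (fun x => (∑ i, X i x) - n * ν.real s) 2 P := hS.sub (memLp_const _)
  refine le_min ?_ ?_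
  · have hvar : ∫ x, ((∑ i, X i x) - n * ν.real s) ^ 2 ∂P = n * (ν.real s * (1 - ν.real s)) := by
      have h1 := variance_sum_pi (μ := fun _ : Fin n => ν)
        (X := fun _ a => if a ∈ s then (1 : ℝ) else 0) fun _ => memLp_ite_mem ν hs 2
      have h2 : (∑ i, fun ω : Fin n → α => if ω i ∈ s then (1 : ℝ) else 0)
          = fun x => ∑ i, X i x := by
        funext x; simp [X]
      rw [h2, variance_eq_integral (Finset.measurable_sum _ fun i _ => hXm i).aemeasurable,
        hSmean] at h1
      rw [h1]
      simp [variance_ite_mem ν hs]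
    rw [← hvar]
    refine Real.le_sqrt_of_sq_le ?_
    -- Nonnegative variance of the absolute deviation gives `(E|D|)² ≤ E D²`.
    have h3 := variance_nonneg |fun x => (∑ i, X i x) - n * ν.real s| P
    rw [variance_eq_sub hD.abs] at h3
    simpa [X] using h3
  · calc ∫ x, |(∑ i, X i x) - n * ν.real s| ∂P
        ≤ ∫ x, ∑ i, |X i x - ν.real s| ∂P := by
          refine integral_mono (hD.abs.integrable (by norm_num))
            (integrable_finsetSum _ fun i _ => ((hXi i).sub (integrable_const _)).abs) fun x => ?_
          refine le_trans (le_of_eq ?_) (Finset.abs_sum_le_sum_abs _ _)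
          simp
      _ = ∑ i, ∫ x, |X i x - ν.real s| ∂P :=
          integral_finsetSum _ fun i _ => ((hXi i).sub (integrable_const _)).abs
      _ = ∑ i : Fin n, 2 * (ν.real s * (1 - ν.real s)) := by
          refine Finset.sum_congr rfl fun i _ => ?_
          rw [← integral_abs_ite_sub_measureReal ν hs]
          have h := integral_map (μ := P) (hmp i).measurable.aemeasurable
            ((measurable_ite_mem hs).sub_const (ν.real s)).abs.aestronglyMeasurable
          rw [(hmp i).map_eq] at h
          exact h.symm
      _ = 2 * (n * (ν.real s * (1 - ν.real s))) := by simp; ring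

theorem lintegral_abs_count_sub_count_le (n : ℕ) {s : Set α} (hs : MeasurableSet s)
    [DecidablePred (· ∈ s)] {q : ℝ} (hq : ν.real s * (1 - ν.real s) ≤ q) :
    ∫⁻ p : (Fin n → α) × (Fin n → α), ENNReal.ofReal
        |∑ i, (if p.1 i ∈ s then (1 : ℝ) else 0) - ∑ i, if p.2 i ∈ s then (1 : ℝ) else 0|
        ∂((Measure.pi fun _ => ν).prod (Measure.pi fun _ => ν))
      ≤ ENNReal.ofReal (2 * min (√(n * q)) (2 * (n * q))) := by
  set P : Measure (Fin n → α) := Measure.pi fun _ => ν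
  set N : (Fin n → α) → ℝ := fun x => (∑ i, if x i ∈ s then (1 : ℝ) else 0) - n * ν.real s
  have hN : Measurable N := (Finset.measurable_sum _ fun i _ =>
    (measurable_ite_mem hs).comp (measurable_pi_apply i)).sub_const _
  have hNint : Integrable N P := (memLp_finsetSum (p := 1) _ fun i _ =>
    (memLp_ite_mem ν hs 1).comp_measurePreserving
      (measurePreserving_eval (fun _ => ν) i)).integrable le_rfl |>.sub (integrable_const _)
  have hbd : ∫⁻ x, ENNReal.ofReal |N x| ∂P
      ≤ ENNReal.ofReal (min (√(n * q)) (2 * (n * q))) := by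
    rw [← ofReal_integral_eq_lintegral_ofReal hNint.abs (.of_forall fun _ => abs_nonneg _)]
    refine ENNReal.ofReal_le_ofReal ((integral_abs_count_sub_le ν n hs).trans ?_)
    gcongr
  calc _ ≤ ∫⁻ p : (Fin n → α) × (Fin n → α),
        (ENNReal.ofReal |N p.1| + ENNReal.ofReal |N p.2|) ∂(P.prod P) := by
        refine lintegral_mono fun p => ?_
        rw [← ENNReal.ofReal_add (abs_nonneg _) (abs_nonneg _)]
        refine ENNReal.ofReal_le_ofReal (le_trans (le_of_eq ?_) (abs_sub (N p.1) (N p.2)))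
        simp [N]
    _ = ∫⁻ x, ENNReal.ofReal |N x| ∂P + ∫⁻ x, ENNReal.ofReal |N x| ∂P := by
        rw [lintegral_add_left (by fun_prop)]
        congr 1
        · exact measurePreserving_fst.lintegral_comp (f := fun x => ENNReal.ofReal |N x|)
            (by fun_prop)
        · exact measurePreserving_snd.lintegral_comp (f := fun x => ENNReal.ofReal |N x|)
            (by fun_prop)
    _ ≤ _ := by
        rw [← two_mul, ENNReal.ofReal_mul (by norm_num), ENNReal.ofReal_ofNat]
        gcongr

end Deviation

/-! ### Two independent samples of the same law. -/

/-- The variance of the indicator of `x |x| ≤ u` is controlled by the fourth moment. -/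
theorem measureReal_mul_one_sub_le (ν : Measure ℝ) [IsProbabilityMeasure ν]
    (hν : Integrable (fun x : ℝ => x ^ 4) ν) {s : ℝ} (hs : ∫ x, x ^ 4 ∂ν ≤ s ^ 2) (u : ℝ) :
    ν.real {x | x * |x| ≤ u} * (1 - ν.real {x | x * |x| ≤ u}) * u ^ 2 ≤ s ^ 2 := by
  set A : Set ℝ := {x | x * |x| ≤ u}
  have hA : MeasurableSet A := measurableSet_le (by fun_prop) measurable_const
  have h0 : 0 ≤ ν.real A := measureReal_nonneg
  have h1 : ν.real A ≤ 1 := measureReal_le_one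
  -- Markov's inequality; it controls the upper tail when `u ≥ 0` and the lower tail when `u ≤ 0`,
  -- the other factor being at most 1.
  have hm : u ^ 2 * ν.real {x | u ^ 2 ≤ x ^ 4} ≤ s ^ 2 :=
    (mul_meas_ge_le_integral_of_nonneg (.of_forall fun x => by positivity) hν _).trans hs
  have hsq (x : ℝ) : (x * |x|) ^ 2 = x ^ 4 := by rw [mul_pow, sq_abs]; ring
  rcases le_total 0 u with hu | hu
  · have h2 : 1 - ν.real A ≤ ν.real {x | u ^ 2 ≤ x ^ 4} := by
      rw [← probReal_compl_eq_one_sub hA]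
      refine measureReal_mono fun x hx => ?_
      have hx' : u < x * |x| := not_le.1 hx
      change u ^ 2 ≤ x ^ 4
      rw [← hsq]
      exact pow_le_pow_left₀ hu hx'.le 2
    nlinarith [mul_le_mul_of_nonneg_right h2 (sq_nonneg u),
      mul_nonneg (mul_nonneg (sub_nonneg.2 h1) (sub_nonneg.2 h1)) (sq_nonneg u)]
  · have h2 : ν.real A ≤ ν.real {x | u ^ 2 ≤ x ^ 4} := by
      refine measureReal_mono fun x hx => ?_
      have hx' : x * |x| ≤ u := hx
      change u ^ 2 ≤ x ^ 4
      rw [← hsq]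
      nlinarith
    nlinarith [mul_le_mul_of_nonneg_right h2 (sq_nonneg u),
      mul_nonneg (mul_nonneg h0 h0) (sq_nonneg u)]

/-- Up to a factor 2, consecutive bounds cross at `s` and `s √N`. Using each on its own range
contributes `1`, `2 log √N = log N` and `4`, in units of `s √N`. -/
theorem setLIntegral_Ioi_le_mul_log {G : ℝ → ℝ≥0∞} {s N : ℝ} (hs : 0 < s) (hN : 1 ≤ N)
    (h1 : ∀ u, 0 < u → G u ≤ ENNReal.ofReal (√N))
    (h2 : ∀ u, 0 < u → G u ≤ ENNReal.ofReal (2 * √N * s * u⁻¹))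
    (h3 : ∀ u, 0 < u → G u ≤ ENNReal.ofReal (4 * N * s ^ 2 * u ^ (-2 : ℝ))) :
    ∫⁻ u in Set.Ioi 0, G u ≤ ENNReal.ofReal (s * √N * (5 + Real.log N)) := by
  have hr : 1 ≤ √N := Real.one_le_sqrt.2 hN
  have hr2 : √N * √N = N := Real.mul_self_sqrt (by linarith)
  have hlog : 0 ≤ Real.log N := Real.log_nonneg hN
  have hsr : s ≤ s * √N := le_mul_of_one_le_right hs.le hr
  have hsr0 : 0 < s * √N := by positivity
  have b1 : ∫⁻ u in Set.Ioc 0 s, G u ≤ ENNReal.ofReal (s * √N) := by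
    calc _ ≤ ∫⁻ _ in Set.Ioc 0 s, ENNReal.ofReal (√N) :=
          setLIntegral_mono' measurableSet_Ioc fun u hu => h1 u hu.1
      _ = _ := by
        rw [setLIntegral_const, Real.volume_Ioc, sub_zero, mul_comm, ENNReal.ofReal_mul hs.le]
  have b2 : ∫⁻ u in Set.Ioc s (s * √N), G u ≤ ENNReal.ofReal (s * √N * Real.log N) := by
    calc _ ≤ ∫⁻ u in Set.Ioc s (s * √N), ENNReal.ofReal (2 * √N * s * u⁻¹) :=
          setLIntegral_mono' measurableSet_Ioc fun u hu => h2 u (hs.trans hu.1)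
      _ = _ := by
        have hi : IntervalIntegrable (fun u : ℝ => 2 * √N * s * u⁻¹) volume s (s * √N) := by
          refine ContinuousOn.intervalIntegrable fun u hu => ?_
          rw [Set.uIcc_of_le hsr] at hu
          have : u ≠ 0 := (hs.trans_le hu.1).ne'
          exact (continuousAt_const.mul (continuousAt_inv₀ this)).continuousWithinAt
        rw [← ofReal_integral_eq_lintegral_ofReal
          ((intervalIntegrable_iff_integrableOn_Ioc_of_le hsr).1 hi),
          ← intervalIntegral.integral_of_le hsr, intervalIntegral.integral_const_mul,
          integral_inv_of_pos hs hsr0, mul_div_cancel_left₀ _ hs.ne', Real.log_sqrt (by linarith)]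
        · congr 1; ring
        · refine (ae_restrict_iff' measurableSet_Ioc).2 (.of_forall fun u hu => ?_)
          have : 0 < u := hs.trans hu.1
          change 0 ≤ 2 * √N * s * u⁻¹
          positivity
  have b3 : ∫⁻ u in Set.Ioi (s * √N), G u ≤ ENNReal.ofReal (4 * (s * √N)) := by
    calc _ ≤ ∫⁻ u in Set.Ioi (s * √N), ENNReal.ofReal (4 * N * s ^ 2 * u ^ (-2 : ℝ)) :=
          setLIntegral_mono' measurableSet_Ioi fun u hu => h3 u (hsr0.trans hu)
      _ = _ := by
        rw [← ofReal_integral_eq_lintegral_ofReal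
          ((integrableOn_Ioi_rpow_of_lt (by norm_num) hsr0).const_mul _), integral_const_mul,
          integral_Ioi_rpow_of_lt (by norm_num) hsr0]
        · congr 1
          rw [show (-2 + 1 : ℝ) = -1 by norm_num, Real.rpow_neg_one]
          nth_rw 1 [← hr2]
          field_simp
        · refine (ae_restrict_iff' measurableSet_Ioi).2 (.of_forall fun u hu => ?_)
          have : 0 < u := hsr0.trans hu
          change 0 ≤ 4 * N * s ^ 2 * u ^ (-2 : ℝ)
          positivity
  rw [← Set.Ioc_union_Ioi_eq_Ioi hs.le, ← Set.Ioc_union_Ioi_eq_Ioi hsr]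
  calc _ ≤ ENNReal.ofReal (s * √N) + (ENNReal.ofReal (s * √N * Real.log N)
          + ENNReal.ofReal (4 * (s * √N))) :=
        (lintegral_union_le _ _ _).trans (add_le_add b1
          ((lintegral_union_le _ _ _).trans (add_le_add b2 b3)))
    _ = _ := by
        rw [← ENNReal.ofReal_add (by positivity) (by positivity),
          ← ENNReal.ofReal_add (by positivity) (by positivity)]
        congr 1; ring

theorem lintegral_le_mul_log {G : ℝ → ℝ≥0∞} {s N : ℝ} (hs : 0 < s) (hN : 1 ≤ N)
    (h1 : ∀ u, G u ≤ ENNReal.ofReal (√N))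
    (h2 : ∀ u, u ≠ 0 → G u ≤ ENNReal.ofReal (2 * √N * s * |u|⁻¹))
    (h3 : ∀ u, u ≠ 0 → G u ≤ ENNReal.ofReal (4 * N * s ^ 2 * |u| ^ (-2 : ℝ))) :
    ∫⁻ u, G u ≤ ENNReal.ofReal (2 * (s * √N * (5 + Real.log N))) := by
  have hp : ∫⁻ u in Set.Ioi 0, G u ≤ ENNReal.ofReal (s * √N * (5 + Real.log N)) :=
    setLIntegral_Ioi_le_mul_log hs hN (fun u _ => h1 u)
      (fun u hu => by simpa [abs_of_pos hu] using h2 u hu.ne')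
      (fun u hu => by simpa [abs_of_pos hu] using h3 u hu.ne')
  have hn : ∫⁻ u in Set.Ioi 0, G (-u) ≤ ENNReal.ofReal (s * √N * (5 + Real.log N)) :=
    setLIntegral_Ioi_le_mul_log hs hN (fun u _ => h1 (-u))
      (fun u hu => by simpa [abs_of_pos hu] using h2 (-u) (neg_ne_zero.2 hu.ne'))
      (fun u hu => by simpa [abs_of_pos hu] using h3 (-u) (neg_ne_zero.2 hu.ne'))
  have hrefl : ∫⁻ u in Set.Iic 0, G u = ∫⁻ u in Set.Ioi 0, G (-u) := by
    rw [setLIntegral_congr (Iio_ae_eq_Iic (μ := volume) (a := (0 : ℝ))).symm]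
    have h := (Measure.measurePreserving_neg (volume : Measure ℝ)).setLIntegral_comp_preimage_emb
      (MeasurableEquiv.neg ℝ).measurableEmbedding G (Set.Iio 0)
    rw [← h]
    simp
  rw [← lintegral_add_compl G (measurableSet_Ioi (a := (0 : ℝ))), Set.compl_Ioi, hrefl, two_mul,
    ENNReal.ofReal_add (by have := Real.log_nonneg hN; positivity)
      (by have := Real.log_nonneg hN; positivity)]
  exact add_le_add hp hn

theorem lintegral_rankedSqDist_prod_self_le (ν : Measure ℝ) [IsProbabilityMeasure ν]
    (hν : Integrable (fun x : ℝ => x ^ 4) ν) {s : ℝ} (hs0 : 0 < s) (hs : ∫ x, x ^ 4 ∂ν ≤ s ^ 2)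
    {n : ℕ} (hn : 1 ≤ n) :
    ∫⁻ p : (Fin n → ℝ) × (Fin n → ℝ), rankedSqDist p.1 p.2
        ∂((Measure.pi fun _ => ν).prod (Measure.pi fun _ => ν))
      ≤ ENNReal.ofReal (4 * (s * √n * (5 + Real.log n))) := by
  set P : Measure ((Fin n → ℝ) × (Fin n → ℝ)) :=
    (Measure.pi fun _ => ν).prod (Measure.pi fun _ => ν)
  set F : (Fin n → ℝ) × (Fin n → ℝ) → ℝ → ℝ≥0∞ := fun p u => ENNReal.ofReal
      |∑ i, (if p.1 i * |p.1 i| ≤ u then (1 : ℝ) else 0) -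
        ∑ i, if p.2 i * |p.2 i| ≤ u then (1 : ℝ) else 0|
  have hF : Measurable (Function.uncurry F) := by
    refine Measurable.ennreal_ofReal (Measurable.abs (Measurable.sub ?_ ?_)) <;>
    · refine Finset.measurable_sum _ fun i _ => ?_
      exact Measurable.ite (measurableSet_le (by fun_prop) (by fun_prop)) measurable_const
        measurable_const
  have hn' : (1 : ℝ) ≤ n := by exact_mod_cast hn
  have hn0 : (0 : ℝ) < n := by linarith
  have hbd (u : ℝ) {q : ℝ} (hq : ν.real {x | x * |x| ≤ u} * (1 - ν.real {x | x * |x| ≤ u}) ≤ q) :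
      ∫⁻ p, F p u ∂P ≤ ENNReal.ofReal (2 * min (√(n * q)) (2 * (n * q))) :=
    lintegral_abs_count_sub_count_le ν n
      (s := {x | x * |x| ≤ u}) (measurableSet_le (by fun_prop) measurable_const) hq
  have hq (u : ℝ) (hu : u ≠ 0) :
      ν.real {x | x * |x| ≤ u} * (1 - ν.real {x | x * |x| ≤ u}) ≤ s ^ 2 / u ^ 2 :=
    (le_div_iff₀ (by positivity)).2 (measureReal_mul_one_sub_le ν hν hs u)
  have hG : ∫⁻ u, ∫⁻ p, F p u ∂P ≤ ENNReal.ofReal (2 * (s * √n * (5 + Real.log n))) := by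
    refine lintegral_le_mul_log hs0 hn' (fun u => ?_) (fun u hu => ?_) (fun u hu => ?_)
    -- The three bounds use `p(1-p) ≤ 1/4` with the square root, then `s²/u²` with the square root,
    -- then `s²/u²` with the linear bound.
    · refine (hbd u (q := 1 / 4)
        (by nlinarith [sq_nonneg (ν.real {x | x * |x| ≤ u} - 1 / 2)])).trans
        (ENNReal.ofReal_le_ofReal ?_)
      refine (mul_le_mul_of_nonneg_left (min_le_left _ _) two_pos.le).trans (le_of_eq ?_)
      rw [Real.sqrt_mul hn0.le, show (1 / 4 : ℝ) = (1 / 2) ^ 2 by norm_num,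
        Real.sqrt_sq (by norm_num)]
      ring
    · refine (hbd u (hq u hu)).trans (ENNReal.ofReal_le_ofReal ?_)
      refine (mul_le_mul_of_nonneg_left (min_le_left _ _) two_pos.le).trans (le_of_eq ?_)
      rw [Real.sqrt_mul hn0.le, ← sq_abs u, ← div_pow, Real.sqrt_sq (by positivity)]
      ring
    · refine (hbd u (hq u hu)).trans (ENNReal.ofReal_le_ofReal ?_)
      refine (mul_le_mul_of_nonneg_left (min_le_right _ _) two_pos.le).trans (le_of_eq ?_)
      rw [Real.rpow_neg (abs_nonneg u), Real.rpow_ofNat, sq_abs]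
      ring
  calc ∫⁻ p, rankedSqDist p.1 p.2 ∂P ≤ ∫⁻ p, (2 * ∫⁻ u, F p u) ∂P :=
        lintegral_mono fun p => rankedSqDist_le_lintegral p.1 p.2
    _ = 2 * ∫⁻ u, ∫⁻ p, F p u ∂P := by
        rw [lintegral_const_mul' _ _ (by simp), lintegral_lintegral_swap hF.aemeasurable]
    _ ≤ 2 * ENNReal.ofReal (2 * (s * √n * (5 + Real.log n))) := by gcongr
    _ = _ := by
        rw [← ENNReal.ofReal_ofNat 2, ← ENNReal.ofReal_mul (by norm_num)]
        congr 1; ring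

/-! ### Comparison with an arbitrary coupling. -/

theorem lintegral_rankedSqDist_le_of_mem_couplings {μ ν : Measure ℝ} [IsProbabilityMeasure μ]
    [IsProbabilityMeasure ν] {γ : Measure (ℝ × ℝ)} (hγ : γ ∈ couplings μ ν) (n : ℕ) :
    ∫⁻ p : (Fin n → ℝ) × (Fin n → ℝ), rankedSqDist p.1 p.2
        ∂((Measure.pi fun _ => μ).prod (Measure.pi fun _ => ν))
      ≤ 2 * (n * ∫⁻ p, ENNReal.ofReal (|p.1 - p.2| ^ 2) ∂γ)
        + 2 * ∫⁻ p : (Fin n → ℝ) × (Fin n → ℝ), rankedSqDist p.1 p.2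
          ∂((Measure.pi fun _ => ν).prod (Measure.pi fun _ => ν)) := by
  have hγ1 : MeasurePreserving Prod.fst γ μ := ⟨measurable_fst, hγ.1⟩
  have hγ2 : MeasurePreserving Prod.snd γ ν := ⟨measurable_snd, hγ.2⟩
  have : IsProbabilityMeasure γ :=
    ⟨by simpa using hγ1.measure_preimage MeasurableSet.univ.nullMeasurableSet⟩
  set Γ : Measure (Fin n → ℝ × ℝ) := Measure.pi fun _ => γ
  set N : Measure (Fin n → ℝ) := Measure.pi fun _ => ν
  have h1 : MeasurePreserving (fun (g : Fin n → ℝ × ℝ) i => (g i).1) Γ (Measure.pi fun _ => μ) :=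
    measurePreserving_pi _ _ fun _ => hγ1
  have h2 : MeasurePreserving (fun (g : Fin n → ℝ × ℝ) i => (g i).2) Γ N :=
    measurePreserving_pi _ _ fun _ => hγ2
  -- Both expectations move to one space carrying `n` coupled pairs and an independent sample of
  -- `ν`.
  have e1 := (h1.prod (MeasurePreserving.id N)).lintegral_comp
    (measurable_fst.rankedSqDist measurable_snd)
  have e2 := (h2.prod (MeasurePreserving.id N)).lintegral_comp
    (measurable_fst.rankedSqDist measurable_snd)
  rw [← e1, ← e2]
  have hm : Measurable fun p : (Fin n → ℝ × ℝ) × (Fin n → ℝ) =>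
      rankedSqDist (fun i => (p.1 i).1) (fun i => (p.1 i).2) :=
    Measurable.rankedSqDist (by fun_prop) (by fun_prop)
  have hterm (i : Fin n) : ∫⁻ p : (Fin n → ℝ × ℝ) × (Fin n → ℝ),
      ENNReal.ofReal (((p.1 i).1 - (p.1 i).2) ^ 2) ∂(Γ.prod N)
        = ∫⁻ p, ENNReal.ofReal (|p.1 - p.2| ^ 2) ∂γ := by
    have h := ((measurePreserving_eval (fun _ : Fin n => γ) i).comp
      (measurePreserving_fst (μ := Γ) (ν := N))).lintegral_comp
      (f := fun p => ENNReal.ofReal (|p.1 - p.2| ^ 2)) (by fun_prop)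
    simpa [sq_abs] using h
  calc _ ≤ ∫⁻ p, (2 * rankedSqDist (fun i => (p.1 i).1) (fun i => (p.1 i).2)
        + 2 * rankedSqDist (fun i => (p.1 i).2) p.2) ∂(Γ.prod N) :=
        lintegral_mono fun p => rankedSqDist_le_two_mul_add _ _ _
    _ = 2 * ∫⁻ p, rankedSqDist (fun i => (p.1 i).1) (fun i => (p.1 i).2) ∂(Γ.prod N)
        + 2 * ∫⁻ p, rankedSqDist (fun i => (p.1 i).2) p.2 ∂(Γ.prod N) := by
        rw [lintegral_add_left (hm.const_mul 2), lintegral_const_mul' _ _ (by simp),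
          lintegral_const_mul' _ _ (by simp)]
    _ ≤ _ := by
        refine add_le_add (mul_le_mul_right ?_ _) le_rfl
        refine (lintegral_mono fun p => rankedSqDist_le_sum _ _).trans ?_
        rw [lintegral_finsetSum _ fun i _ => by fun_prop]
        simp only [hterm]
        simp

theorem lintegral_uniformOn_univ {n : ℕ} (f : Fin n → ℝ≥0∞) :
    ∫⁻ i, f i ∂(uniformOn Set.univ) = (n : ℝ≥0∞)⁻¹ * ∑ i, f i := by
  rw [lintegral_fintype, Finset.mul_sum]
  refine Finset.sum_congr rfl fun i _ => ?_
  rw [uniformOn_univ, Measure.count_singleton, Fintype.card_fin, one_div, mul_comm]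

theorem measurable_orderStat_uncurry {n : ℕ} :
    Measurable fun p : Fin n × (Fin n → ℝ) => orderStat p.2 p.1 :=
  measurable_from_prod_countable_right fun i => measurable_orderStat i

/-! ### Uniform random rank, and passage to the infimum over couplings. -/

section Sample

variable {Ω : Type*} [MeasurableSpace Ω] {P : Measure Ω} [IsProbabilityMeasure P] {n : ℕ}
  {U : Ω → Fin n}

theorem lintegral_uniform_index {β : Type*} [MeasurableSpace β] {Y : Ω → β} {μ : Measure β}
    [IsProbabilityMeasure μ] (hU : HasLaw U (uniformOn Set.univ) P) (hY : HasLaw Y μ P)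
    (hind : IndepFun U Y P) {G : Fin n → β → ℝ≥0∞} (hG : ∀ i, Measurable (G i)) :
    ∫⁻ ω, G (U ω) (Y ω) ∂P = (n : ℝ≥0∞)⁻¹ * ∫⁻ y, ∑ i, G i y ∂μ := by
  have hmap := (indepFun_iff_map_prod_eq_prod_map_map hU.aemeasurable hY.aemeasurable).1 hind
  rw [hU.map_eq, hY.map_eq] at hmap
  have hGm : Measurable fun p : Fin n × β => G p.1 p.2 :=
    measurable_from_prod_countable_right fun i => hG i
  have h := lintegral_map' (μ := P) (g := fun ω => (U ω, Y ω)) hGm.aemeasurable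
    (hU.aemeasurable.prodMk hY.aemeasurable)
  rw [← h, hmap, lintegral_prod _ hGm.aemeasurable, lintegral_uniformOn_univ,
    lintegral_finsetSum _ fun i _ => hG i]

/-- Sorting only permutes the sample, so averaging over all ranks equals averaging over all indices.
-/
theorem hasLaw_orderStat_uniform {X : Ω → Fin n → ℝ} {μ : Measure ℝ} [IsProbabilityMeasure μ]
    (hn : n ≠ 0) (hU : HasLaw U (uniformOn Set.univ) P)
    (hX : HasLaw X (Measure.pi fun _ => μ) P) (hind : IndepFun U X P) :
    HasLaw (fun ω => orderStat (X ω) (U ω)) μ P := by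
  have hm : AEMeasurable (fun ω => orderStat (X ω) (U ω)) P :=
    measurable_orderStat_uncurry.comp_aemeasurable (hU.aemeasurable.prodMk hX.aemeasurable)
  refine ⟨hm, Measure.ext fun s hs => ?_⟩
  have hind1 : Measurable (s.indicator (1 : ℝ → ℝ≥0∞)) := measurable_one.indicator hs
  rw [← lintegral_indicator_one hs, lintegral_map' hind1.aemeasurable hm,
    lintegral_uniform_index hU hX hind
      (G := fun i x => s.indicator (1 : ℝ → ℝ≥0∞) (orderStat x i))
      fun i => hind1.comp (measurable_orderStat i)]
  simp only [sum_orderStat]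
  rw [lintegral_finsetSum (f := fun i (x : Fin n → ℝ) => s.indicator (1 : ℝ → ℝ≥0∞) (x i)) _
    fun i _ => hind1.comp (measurable_pi_apply i)]
  have h (i : Fin n) : ∫⁻ x : Fin n → ℝ, s.indicator (1 : ℝ → ℝ≥0∞) (x i) ∂(Measure.pi fun _ => μ)
      = μ s := by
    rw [← lintegral_indicator_one hs]
    exact (measurePreserving_eval (fun _ => μ) i).lintegral_comp hind1
  simp only [h, Finset.sum_const, Finset.card_univ, Fintype.card_fin, nsmul_eq_mul]
  rw [← mul_assoc, ENNReal.inv_mul_cancel (by exact_mod_cast hn) (by simp), one_mul]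

theorem hasLaw_pi_of_iIndepFun {X : Fin n → Ω → ℝ} {μ : Measure ℝ}
    (hX : ∀ i, HasLaw (X i) μ P) (hind : iIndepFun X P) :
    HasLaw (fun ω i => X i ω) (Measure.pi fun _ => μ) P := by
  refine ⟨aemeasurable_pi_lambda _ fun i => (hX i).aemeasurable, ?_⟩
  rw [(iIndepFun_iff_map_fun_eq_pi_map fun i => (hX i).aemeasurable).1 hind]
  simp only [(hX _).map_eq]

theorem lintegral_sq_orderStat_sub_le {X Y : Ω → Fin n → ℝ} {μ ν : Measure ℝ}
    [IsProbabilityMeasure μ] [IsProbabilityMeasure ν] (hn : 1 ≤ n)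
    (hU : HasLaw U (uniformOn Set.univ) P)
    (hXY : HasLaw (fun ω => (X ω, Y ω)) ((Measure.pi fun _ => μ).prod (Measure.pi fun _ => ν)) P)
    (hind : IndepFun U (fun ω => (X ω, Y ω)) P) (hν : Integrable (fun x : ℝ => x ^ 4) ν)
    {s : ℝ} (hs0 : 0 < s) (hs : ∫ x, x ^ 4 ∂ν ≤ s ^ 2) :
    ∫⁻ ω, ENNReal.ofReal ((orderStat (X ω) (U ω) - orderStat (Y ω) (U ω)) ^ 2) ∂P
      ≤ 2 * wasserstein2 μ ν ^ 2 + ENNReal.ofReal (8 * (5 + Real.log n) / √n * s) := by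
  have hn0 : (n : ℝ≥0∞) ≠ 0 := by exact_mod_cast (by omega : n ≠ 0)
  have hlog : 0 ≤ Real.log n := Real.log_natCast_nonneg n
  have hnR : (0 : ℝ) < n := by exact_mod_cast hn
  set K := ENNReal.ofReal (8 * (5 + Real.log n) / √n * s)
  have hcoup : ∀ γ ∈ couplings μ ν,
      ∫⁻ ω, ENNReal.ofReal ((orderStat (X ω) (U ω) - orderStat (Y ω) (U ω)) ^ 2) ∂P
        ≤ 2 * ∫⁻ p, ENNReal.ofReal (|p.1 - p.2| ^ 2) ∂γ + K := by
    intro γ hγ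
    rw [lintegral_uniform_index hU hXY hind
      (G := fun i p => ENNReal.ofReal ((orderStat p.1 i - orderStat p.2 i) ^ 2)) fun i =>
        (((measurable_orderStat i).comp measurable_fst).sub
          ((measurable_orderStat i).comp measurable_snd)).pow_const 2 |>.ennreal_ofReal]
    calc _ ≤ (n : ℝ≥0∞)⁻¹ * (2 * (n * ∫⁻ p, ENNReal.ofReal (|p.1 - p.2| ^ 2) ∂γ)
          + 2 * ENNReal.ofReal (4 * (s * √n * (5 + Real.log n)))) := by
          refine mul_le_mul_right ((lintegral_rankedSqDist_le_of_mem_couplings hγ n).trans ?_) _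
          gcongr
          exact lintegral_rankedSqDist_prod_self_le ν hν hs0 hs hn
      _ = _ := by
          rw [mul_add, mul_left_comm 2, ← mul_assoc, ENNReal.inv_mul_cancel hn0 (by simp), one_mul]
          congr 1
          rw [← ENNReal.ofReal_natCast, ← ENNReal.ofReal_inv_of_pos hnR, ← ENNReal.ofReal_ofNat 2,
            ← ENNReal.ofReal_mul (by norm_num), ← ENNReal.ofReal_mul (by positivity)]
          congr 1
          nth_rw 1 [← Real.mul_self_sqrt hnR.le]
          field_simp
          ring
  have hW : ∀ L : ℝ≥0∞, (∀ γ ∈ couplings μ ν,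
      L ≤ 2 * ∫⁻ p, ENNReal.ofReal (|p.1 - p.2| ^ 2) ∂γ + K) → L ≤ 2 * wasserstein2 μ ν ^ 2 + K := by
    intro L hL
    -- The infimum is of square roots, so the bound is solved for the cost and rooted first;
    -- truncated subtraction is harmless here.
    have h1 : ((L - K) / 2) ^ (1 / 2 : ℝ) ≤ wasserstein2 μ ν := by
      refine le_iInf₂ fun γ hγ => ENNReal.rpow_le_rpow ?_ (by norm_num)
      rw [ENNReal.div_le_iff two_ne_zero (by simp), mul_comm]
      exact tsub_le_iff_right.2 (hL γ hγ)
    have h2 : (L - K) / 2 ≤ wasserstein2 μ ν ^ 2 := by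
      have := ENNReal.rpow_le_rpow h1 (zero_le_two (α := ℝ))
      rwa [← ENNReal.rpow_mul, one_div, inv_mul_cancel₀ two_ne_zero, ENNReal.rpow_one,
        ENNReal.rpow_two] at this
    rw [ENNReal.div_le_iff two_ne_zero (by simp), mul_comm] at h2
    exact tsub_le_iff_right.1 h2
  exact hW _ hcoup

end Sample

theorem wasserstein2_ne_top {μ ν : Measure ℝ} [IsProbabilityMeasure μ] [IsProbabilityMeasure ν]
    (hμ : Integrable (fun x : ℝ => x ^ 4) μ) (hν : Integrable (fun x : ℝ => x ^ 4) ν) :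
    wasserstein2 μ ν ≠ ∞ := by
  -- The independent coupling already has finite cost.
  have hmem : μ.prod ν ∈ couplings μ ν := ⟨by simp, by simp⟩
  have hi : Integrable (fun p : ℝ × ℝ => 4 + 2 * p.1 ^ 4 + 2 * p.2 ^ 4) (μ.prod ν) :=
    ((integrable_const _).add ((hμ.comp_fst ν).const_mul 2)).add ((hν.comp_snd μ).const_mul 2)
  refine ne_top_of_le_ne_top ?_ (iInf₂_le _ hmem)
  refine ENNReal.rpow_ne_top_of_nonneg (by norm_num) (ne_top_of_le_ne_top hi.lintegral_lt_top.ne ?_)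
  refine lintegral_mono fun p => ENNReal.ofReal_le_ofReal ?_
  rw [sq_abs]
  nlinarith [sq_nonneg (p.1 + p.2), sq_nonneg (p.1 ^ 2 - 1), sq_nonneg (p.2 ^ 2 - 1)]

theorem lemmaB1 :
    ∃ c : ℝ, 0 < c ∧
      ∀ (Ω : Type*) [MeasurableSpace Ω] (P : Measure Ω) [IsProbabilityMeasure P]
        (μξ μζ : Measure ℝ) (n : ℕ) (ξ ζ : Fin n → Ω → ℝ) (U : Ω → Fin n),
        2 ≤ n →
        Integrable (fun x : ℝ => x ^ 4) μξ →
        Integrable (fun x : ℝ => x ^ 4) μζ →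
        (∀ i, HasLaw (ξ i) μξ P) →
        (∀ i, HasLaw (ζ i) μζ P) →
        HasLaw U (uniformOn Set.univ) P →
        iIndepFun ξ P →
        iIndepFun ζ P →
        IndepFun (fun ω i => ξ i ω) (fun ω i => ζ i ω) P →
        IndepFun U (fun ω => (fun i => ξ i ω, fun i => ζ i ω)) P →
          HasLaw (fun ω => orderStat (fun i => ξ i ω) (U ω)) μξ P ∧
          HasLaw (fun ω => orderStat (fun i => ζ i ω) (U ω)) μζ P ∧
          wasserstein2 μξ μζ ≠ ∞ ∧
          Integrable (fun ω => (orderStat (fun i => ξ i ω) (U ω)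
            - orderStat (fun i => ζ i ω) (U ω)) ^ 2) P ∧
          ∫ ω, (orderStat (fun i => ξ i ω) (U ω)
            - orderStat (fun i => ζ i ω) (U ω)) ^ 2 ∂P
            ≤ 3 * (wasserstein2 μξ μζ).toReal ^ 2
              + c * Real.log n / Real.sqrt n
                * (Real.sqrt (∫ x, x ^ 4 ∂μξ) + Real.sqrt (∫ x, x ^ 4 ∂μζ)) := by
  -- Since `log n ≥ 0.69` for `n ≥ 2`, `8 (5 + log n) ≤ 70 log n`.
  refine ⟨70, by norm_num, ?_⟩
  intro Ω _ P _ μξ μζ n ξ ζ U hn hMξ hMζ hξ hζ hU hiξ hiζ hξζ hUind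
  have hξ0 := hξ ⟨0, by omega⟩
  have hζ0 := hζ ⟨0, by omega⟩
  have : IsProbabilityMeasure μξ := hξ0.isProbabilityMeasure_iff.1 inferInstance
  have : IsProbabilityMeasure μζ := hζ0.isProbabilityMeasure_iff.1 inferInstance
  have hX := hasLaw_pi_of_iIndepFun hξ hiξ
  have hY := hasLaw_pi_of_iIndepFun hζ hiζ
  have hXY : HasLaw (fun ω => ((fun i => ξ i ω), (fun i => ζ i ω)))
      ((Measure.pi fun _ => μξ).prod (Measure.pi fun _ => μζ)) P := by
    refine ⟨hX.aemeasurable.prodMk hY.aemeasurable, ?_⟩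
    rw [(indepFun_iff_map_prod_eq_prod_map_map hX.aemeasurable hY.aemeasurable).1 hξζ,
      hX.map_eq, hY.map_eq]
  have lawξ := hasLaw_orderStat_uniform (by omega) hU hX (hUind.comp measurable_id measurable_fst)
  have lawζ := hasLaw_orderStat_uniform (by omega) hU hY (hUind.comp measurable_id measurable_snd)
  have hW := wasserstein2_ne_top hMξ hMζ
  have hbd := fun s hs0 hs => lintegral_sq_orderStat_sub_le (s := s) (by omega) hU hXY hUind hMζ
    hs0 hs
  set D : Ω → ℝ := fun ω => (orderStat (fun i => ξ i ω) (U ω)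
    - orderStat (fun i => ζ i ω) (U ω)) ^ 2
  have hDm : AEStronglyMeasurable D P :=
    ((lawξ.aemeasurable.sub lawζ.aemeasurable).pow_const 2).aestronglyMeasurable
  have hD0 : 0 ≤ᵐ[P] D := .of_forall fun ω => sq_nonneg _
  have hM0 : 0 ≤ ∫ x, x ^ 4 ∂μζ := integral_nonneg fun x => by positivity
  -- The scale `s` must be positive, but the fourth moment may vanish; `ε` is removed in `hlim`.
  have hmom (ε : ℝ) (hε : 0 < ε) : ∫ x, x ^ 4 ∂μζ ≤ (√(∫ x, x ^ 4 ∂μζ) + ε) ^ 2 := by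
    nlinarith [Real.sq_sqrt hM0, Real.sqrt_nonneg (∫ x, x ^ 4 ∂μζ)]
  have hfin (s : ℝ) : 2 * wasserstein2 μξ μζ ^ 2 +
      ENNReal.ofReal (8 * (5 + Real.log n) / √n * s) ≠ ∞ :=
    ENNReal.add_ne_top.2 ⟨ENNReal.mul_ne_top (by simp) (ENNReal.pow_ne_top hW),
      ENNReal.ofReal_ne_top⟩
  have hDi : Integrable D P := by
    refine ⟨hDm, (hasFiniteIntegral_iff_ofReal hD0).2 ?_⟩
    exact (hbd _ (by positivity) (hmom 1 one_pos)).trans_lt (hfin _).lt_top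
  refine ⟨lawξ, lawζ, hW, hDi, ?_⟩
  have hn2 : (2 : ℝ) ≤ n := by exact_mod_cast hn
  have hlog : 0.69 ≤ Real.log n := by
    have := Real.log_le_log two_pos hn2
    linarith [Real.log_two_gt_d9]
  have hsqrt : 0 < √(n : ℝ) := Real.sqrt_pos.2 (by linarith)
  have hk : 0 < 8 * (5 + Real.log n) / √n := by positivity
  have hreal (ε : ℝ) (hε : 0 < ε) : ∫ ω, D ω ∂P ≤ 2 * (wasserstein2 μξ μζ).toReal ^ 2
      + 8 * (5 + Real.log n) / √n * (√(∫ x, x ^ 4 ∂μζ) + ε) := by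
    rw [integral_eq_lintegral_of_nonneg_ae hD0 hDm]
    refine (ENNReal.toReal_mono (hfin _) (hbd _ (by positivity) (hmom ε hε))).trans (le_of_eq ?_)
    rw [ENNReal.toReal_add (ENNReal.mul_ne_top (by simp) (ENNReal.pow_ne_top hW))
      ENNReal.ofReal_ne_top, ENNReal.toReal_ofReal (by positivity)]
    simp
  have hlim : ∫ ω, D ω ∂P ≤ 2 * (wasserstein2 μξ μζ).toReal ^ 2
      + 8 * (5 + Real.log n) / √n * √(∫ x, x ^ 4 ∂μζ) := by
    refine le_of_forall_pos_le_add fun δ hδ => (hreal (δ / (8 * (5 + Real.log n) / √n))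
      (by positivity)).trans (le_of_eq ?_)
    rw [mul_add, mul_div_cancel₀ _ hk.ne', add_assoc]
  -- The bound `hlim` is stronger than required: factor 2 instead of 3, and only the moment of `μζ`.
  refine hlim.trans (add_le_add ?_ ?_)
  · nlinarith [sq_nonneg (wasserstein2 μξ μζ).toReal]
  · refine mul_le_mul ?_ (le_add_of_nonneg_left (Real.sqrt_nonneg _)) (Real.sqrt_nonneg _)
      (by positivity)
    exact div_le_div_of_nonneg_right (by linarith) hsqrt.le
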